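/- Let $n\ge 1$, let $\gamma$ be the standard Gaussian measure on $\mathbb R^n$, and write $\|h\|_2=(\mathbb E_{X\sim\gamma}h(X)^2)^{1/2}$. Let $\phi(x)=\frac1{\sqrt{2\pi}}e^{-x^2/2}$ and $\Phi(x)=\int_{-\infty}^x\phi(t)\,dt$, let $C^*\approx 0.25573$ be the unique $C\in(0,1)$ with $4\phi(C)^2-4\Phi(-C)+1=0$, and let $\lambda^*=2C^*\phi(C^*)\approx 0.19748$. Let $\Pi_1$ be the orthogonal projection of $L^2(\gamma)$ onto the span of the Hermite polynomials of degree $1$, and let $A_{DR}=\Pi_1-\lambda^* I$ be the Davie–Reeds operator on $L^2(\gamma)$. For measurable $f,g:\mathbb R^n\to\{\pm1\}$ put $$\mathrm{val}_{A_{DR}}(f,g)=\mathbb E_{X\sim\gamma}\,(A_{DR}f)(X)\,g(X),\qquad \mathrm{val}(A_{DR})=\sup_{f,g:\mathbb R^n\to\{\pm1\}}\mathrm{val}_{A_{DR}}(f,g).$$ Call measurable $f,g:\mathbb R^n\to\{\pm1\}$ *Davie–Reeds strip functions* if there is an orthogonal map $T\in O(n)$ such that for almost every $x\in\mathbb R^n$: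 $f(Tx)=g(Tx)=1$ if $x_1\ge C^*$; $f(Tx)=-g(Tx)$ if $-C^*<x_1<C^*$; and $f(Tx)=g(Tx)=-1$ if $x_1\le -C^*$. **Lemma.** Let $\eta\in\mathbb R$ and let $f,g:\mathbb R^n\to\{\pm1\}$ be measurable functions with $\mathrm{val}_{A_{DR}}(f,g)\ge \mathrm{val}(A_{DR})-\eta$ (so that necessarily $\eta\ge 0$). Then there exist Davie–Reeds strip functions $f_{DR},g_{DR}:\mathbb R^n\to\{\pm1\}$ such that $$\|f-f_{DR}\|_2\le 6\eta^{1/4}\qquad\text{and}\qquad \|g-g_{DR}\|_2\le 6\eta^{1/4}.$$ -/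

import Mathlib

open MeasureTheory ProbabilityTheory

namespace DavieReeds

noncomputable section

/-! ### Univariate Gaussian density and distribution function -/

/-- The standard Gaussian density `φ(x) = (2π)^{-1/2} e^{-x²/2}`. -/
def gaussPDF (x : ℝ) : ℝ := (Real.sqrt (2 * Real.pi))⁻¹ * Real.exp (-x ^ 2 / 2)

/-- The standard Gaussian distribution function `Φ(x) = ∫_{-∞}^x φ(t) dt`. -/
def gaussCDF (x : ℝ) : ℝ := ∫ t in Set.Iic x, gaussPDF t

theorem gaussPDF_eq : gaussPDF = gaussianPDFReal 0 1 := by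
  funext x
  simp [gaussPDF, gaussianPDFReal]

theorem gaussPDF_pos (x : ℝ) : 0 < gaussPDF x := by
  unfold gaussPDF; positivity

theorem continuous_gaussPDF : Continuous gaussPDF := by
  unfold gaussPDF; fun_prop

theorem integrable_gaussPDF : Integrable gaussPDF := by
  rw [gaussPDF_eq]; exact integrable_gaussianPDFReal 0 1

theorem gaussPDF_neg (x : ℝ) : gaussPDF (-x) = gaussPDF x := by
  simp [gaussPDF]

theorem gaussCDF_zero : gaussCDF 0 = 1 / 2 := by
  have h1 : (∫ t in Set.Iic (0 : ℝ), gaussPDF t) + ∫ t in Set.Ioi (0 : ℝ), gaussPDF t = 1 := by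
    rw [intervalIntegral.integral_Iic_add_Ioi integrable_gaussPDF.integrableOn
      integrable_gaussPDF.integrableOn, gaussPDF_eq]
    exact integral_gaussianPDFReal_eq_one 0 one_ne_zero
  have h2 : (∫ t in Set.Iic (0 : ℝ), gaussPDF t) = ∫ t in Set.Ioi (0 : ℝ), gaussPDF t := by
    have := integral_comp_neg_Iic (0 : ℝ) gaussPDF
    simpa [gaussPDF_neg] using this
  unfold gaussCDF
  linarith

theorem hasDerivAt_gaussCDF (x : ℝ) : HasDerivAt gaussCDF (gaussPDF x) x := by
  have h : gaussCDF = fun y => gaussCDF 0 + ∫ t in (0 : ℝ)..y, gaussPDF t := by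
    funext y
    have := intervalIntegral.integral_Iic_sub_Iic (μ := volume) (f := gaussPDF) (a := 0) (b := y)
      integrable_gaussPDF.integrableOn integrable_gaussPDF.integrableOn
    unfold gaussCDF
    linarith
  rw [h]
  exact (intervalIntegral.integral_hasDerivAt_right
    (continuous_gaussPDF.intervalIntegrable _ _)
    (continuous_gaussPDF.stronglyMeasurableAtFilter _ _)
    continuous_gaussPDF.continuousAt).const_add _

theorem hasDerivAt_gaussPDF (x : ℝ) : HasDerivAt gaussPDF (-x * gaussPDF x) x := by
  have h : HasDerivAt (fun y : ℝ => -y ^ 2 / 2) (-x) x := by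
    refine ((hasDerivAt_pow 2 x).neg.div_const 2).congr_deriv ?_
    push_cast
    ring
  refine ((h.exp).const_mul (Real.sqrt (2 * Real.pi))⁻¹).congr_deriv ?_
  unfold gaussPDF
  ring

/-- The function `4φ(C)² - 4Φ(-C) + 1`, whose zero in `(0,1)` is the constant `C*`. -/
def criticalFun (C : ℝ) : ℝ := 4 * gaussPDF C ^ 2 - 4 * gaussCDF (-C) + 1

theorem hasDerivAt_criticalFun (x : ℝ) :
    HasDerivAt criticalFun (4 * gaussPDF x * (1 - 2 * x * gaussPDF x)) x := by
  have h1 := ((hasDerivAt_gaussPDF x).pow 2).const_mul 4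
  have h2 := ((hasDerivAt_gaussCDF (-x)).comp x (hasDerivAt_neg x)).const_mul 4
  have h3 := (h1.sub h2).add_const 1
  refine h3.congr_deriv ?_
  rw [gaussPDF_neg]
  push_cast
  ring

theorem gaussPDF_lt_half (x : ℝ) : gaussPDF x < 1 / 2 := by
  have hpi := Real.pi_gt_three
  have h2 : (2 : ℝ) < Real.sqrt (2 * Real.pi) := by
    rw [Real.lt_sqrt (by norm_num)]; linarith
  have h3 : Real.exp (-x ^ 2 / 2) ≤ 1 := by
    rw [Real.exp_le_one_iff]; nlinarith [sq_nonneg x]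
  have h4 : (Real.sqrt (2 * Real.pi))⁻¹ < 1 / 2 := by
    rw [inv_lt_comm₀ (by linarith) (by norm_num)]; linarith
  have h5 : 0 < (Real.sqrt (2 * Real.pi))⁻¹ := by positivity
  unfold gaussPDF
  nlinarith

theorem strictMonoOn_criticalFun : StrictMonoOn criticalFun (Set.Icc 0 1) := by
  apply strictMonoOn_of_deriv_pos (convex_Icc 0 1)
  · exact fun x _ => (hasDerivAt_criticalFun x).continuousAt.continuousWithinAt
  · intro x hx
    rw [interior_Icc] at hx
    rw [(hasDerivAt_criticalFun x).deriv]
    have h1 := gaussPDF_pos x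
    have h2 := gaussPDF_lt_half x
    have h3 : x * gaussPDF x < 1 * (1 / 2) :=
      mul_lt_mul'' hx.2 h2 hx.1.le h1.le
    exact mul_pos (by linarith) (by linarith)

theorem criticalFun_zero_neg : criticalFun 0 < 0 := by
  have h1 := gaussPDF_pos 0
  have h2 := gaussPDF_lt_half 0
  unfold criticalFun
  rw [neg_zero, gaussCDF_zero]
  nlinarith

theorem gaussPDF_one_gt : 11 / 50 < gaussPDF 1 := by
  have h2 : Real.sqrt (2 * Real.pi) < 2.6 := by
    rw [Real.sqrt_lt' (by norm_num)]
    nlinarith [Real.pi_lt_d2]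
  have h4 : 1 / 2.6 < (Real.sqrt (2 * Real.pi))⁻¹ := by
    rw [one_div]
    exact inv_strictAnti₀ (by positivity) h2
  have h5 : (0.6 : ℝ) < Real.exp (-1 ^ 2 / 2) := by
    have h6 : Real.exp (-1 ^ 2 / 2) ^ 2 = (Real.exp 1)⁻¹ := by
      rw [← Real.exp_nat_mul, ← Real.exp_neg]; norm_num
    have h7 : (1 / 2.7182818286 : ℝ) < (Real.exp 1)⁻¹ := by
      rw [one_div]
      exact inv_strictAnti₀ (Real.exp_pos 1) Real.exp_one_lt_d9
    have h8 := Real.exp_pos (-1 ^ 2 / 2)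
    norm_num at h7
    nlinarith
  unfold gaussPDF
  have h9 : (1 / 2.6 : ℝ) * 0.6 < (Real.sqrt (2 * Real.pi))⁻¹ * Real.exp (-1 ^ 2 / 2) :=
    mul_lt_mul'' h4 h5 (by norm_num) (by norm_num)
  norm_num at h9 ⊢
  linarith

theorem criticalFun_one_pos : 0 < criticalFun 1 := by
  have h1 : gaussCDF 0 - gaussCDF (-1) = ∫ t in (-1 : ℝ)..0, gaussPDF t := by
    have := intervalIntegral.integral_Iic_sub_Iic (μ := volume) (f := gaussPDF) (a := -1) (b := 0)
      integrable_gaussPDF.integrableOn integrable_gaussPDF.integrableOn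
    exact this
  have h2 : ∫ _t in (-1 : ℝ)..0, gaussPDF 1 ≤ ∫ t in (-1 : ℝ)..0, gaussPDF t := by
    apply intervalIntegral.integral_mono_on (by norm_num) (by simp)
      (continuous_gaussPDF.intervalIntegrable _ _)
    intro x hx
    unfold gaussPDF
    have : Real.exp (-1 ^ 2 / 2) ≤ Real.exp (-x ^ 2 / 2) := by
      apply Real.exp_le_exp.2
      nlinarith [hx.1, hx.2]
    exact mul_le_mul_of_nonneg_left this (by positivity)
  rw [intervalIntegral.integral_const] at h2
  norm_num at h2
  rw [gaussCDF_zero] at h1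
  have h3 := gaussPDF_one_gt
  unfold criticalFun
  nlinarith

theorem existsUnique_criticalPoint :
    ∃! C : ℝ, 0 < C ∧ C < 1 ∧ 4 * gaussPDF C ^ 2 - 4 * gaussCDF (-C) + 1 = 0 := by
  have hc : ContinuousOn criticalFun (Set.Icc 0 1) :=
    fun x _ => (hasDerivAt_criticalFun x).continuousAt.continuousWithinAt
  obtain ⟨C, hC, hC0⟩ := intermediate_value_Ioo zero_le_one hc
    (show (0 : ℝ) ∈ Set.Ioo (criticalFun 0) (criticalFun 1) from
      ⟨criticalFun_zero_neg, criticalFun_one_pos⟩)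
  refine ⟨C, ⟨hC.1, hC.2, hC0⟩, ?_⟩
  rintro D ⟨hD1, hD2, hD0⟩
  exact strictMonoOn_criticalFun.injOn ⟨hD1.le, hD2.le⟩ ⟨hC.1.le, hC.2.le⟩
    (show criticalFun D = criticalFun C from hD0.trans hC0.symm)

/-- The constant `C* ≈ 0.25573`: the unique `C ∈ (0,1)` with `4φ(C)² - 4Φ(-C) + 1 = 0`. -/
def CStar : ℝ := existsUnique_criticalPoint.choose

theorem CStar_spec :
    0 < CStar ∧ CStar < 1 ∧ 4 * gaussPDF CStar ^ 2 - 4 * gaussCDF (-CStar) + 1 = 0 :=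
  existsUnique_criticalPoint.choose_spec.1

/-- The constant `λ* = 2 C* φ(C*) ≈ 0.19748`. -/
def lambdaStar : ℝ := 2 * CStar * gaussPDF CStar

/-! ### Gaussian space and Hermite projections -/

/-- The `n`-dimensional standard Gaussian measure on `ℝⁿ`. -/
abbrev γ (n : ℕ) : Measure (EuclideanSpace ℝ (Fin n)) :=
  stdGaussian (EuclideanSpace ℝ (Fin n))

/-- The real Hilbert space `L²(γ)`. -/
abbrev L2 (n : ℕ) : Type := Lp ℝ 2 (γ n)

/-- The multivariate (probabilists') Hermite polynomial `He_α(x) = ∏ᵢ He_{αᵢ}(xᵢ)`. -/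
def hermiteFun {n : ℕ} (α : Fin n → ℕ) (x : EuclideanSpace ℝ (Fin n)) : ℝ :=
  ∏ i, Polynomial.aeval (x i) (Polynomial.hermite (α i))

/-- Membership in `L^p(γ)` for all finite `p`; an auxiliary notion, closed under products. -/
def AllMoments {n : ℕ} (u : EuclideanSpace ℝ (Fin n) → ℝ) : Prop :=
  ∀ p : NNReal, MemLp u p (γ n)

theorem AllMoments.mul {n : ℕ} {u v : EuclideanSpace ℝ (Fin n) → ℝ}
    (hu : AllMoments u) (hv : AllMoments v) : AllMoments (fun x => u x * v x) := by
  intro p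
  have : ENNReal.HolderTriple ((2 * p : NNReal) : ENNReal) ((2 * p : NNReal) : ENNReal)
      (p : ENNReal) := by
    constructor
    push_cast
    rw [ENNReal.mul_inv (Or.inl (by norm_num)) (Or.inl (by norm_num)), ← add_mul,
      ENNReal.inv_two_add_inv_two, one_mul]
  exact (hv (2 * p)).mul (hu (2 * p))

theorem AllMoments.const {n : ℕ} (c : ℝ) :
    AllMoments (fun _ : EuclideanSpace ℝ (Fin n) => c) :=
  fun _ => memLp_const c

theorem AllMoments.coord {n : ℕ} (i : Fin n) :
    AllMoments (fun x : EuclideanSpace ℝ (Fin n) => x i) := fun p =>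
  MemLp.eval_piLp (IsGaussian.memLp_id (γ n) p ENNReal.coe_ne_top) i

theorem AllMoments.aeval {n : ℕ} (i : Fin n) (q : Polynomial ℤ) :
    AllMoments (fun x : EuclideanSpace ℝ (Fin n) => Polynomial.aeval (x i) q) := by
  induction q using Polynomial.induction_on' with
  | add p q hp hq =>
    intro r
    simpa using! (hp r).add (hq r)
  | monomial k a =>
    have h : AllMoments (fun x : EuclideanSpace ℝ (Fin n) => x i ^ k) := by
      induction k with
      | zero => simpa using! AllMoments.const 1
      | succ k ih => simpa [pow_succ] using! ih.mul (AllMoments.coord i)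
    simpa [Polynomial.aeval_monomial] using! (AllMoments.const (a : ℝ)).mul h

theorem AllMoments.hermiteFun {n : ℕ} (α : Fin n → ℕ) : AllMoments (hermiteFun α) := by
  have h : ∀ s : Finset (Fin n), AllMoments (fun x : EuclideanSpace ℝ (Fin n) =>
      ∏ i ∈ s, Polynomial.aeval (x i) (Polynomial.hermite (α i))) := by
    intro s
    induction s using Finset.induction_on with
    | empty => simpa using! AllMoments.const 1
    | insert a s ha ih =>
      simpa [Finset.prod_insert ha] using! (AllMoments.aeval a _).mul ih
  exact h Finset.univ

theorem memLp_hermiteFun {n : ℕ} (α : Fin n → ℕ) : MemLp (hermiteFun α) 2 (γ n) := by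
  simpa using AllMoments.hermiteFun α 2

/-- `He_α` as an element of `L²(γ)`. -/
def hermiteL2 {n : ℕ} (α : Fin n → ℕ) : L2 n := (memLp_hermiteFun α).toLp (hermiteFun α)

/-- The span of the Hermite polynomials of degree exactly `k`. -/
def hermiteSpace (n k : ℕ) : Submodule ℝ (L2 n) :=
  Submodule.span ℝ (hermiteL2 '' {α : Fin n → ℕ | ∑ i, α i = k})

theorem finite_multiIndex (n k : ℕ) : {α : Fin n → ℕ | ∑ i, α i = k}.Finite := by
  refine (Set.Finite.pi' (fun _ : Fin n => Set.finite_Iic k)).subset ?_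
  intro α hα i
  have hα' : ∑ i, α i = k := hα
  rw [Set.mem_Iic, ← hα']
  exact Finset.single_le_sum (fun _ _ => Nat.zero_le _) (Finset.mem_univ i)

instance instFiniteDimensionalHermiteSpace (n k : ℕ) :
    FiniteDimensional ℝ (hermiteSpace n k) :=
  FiniteDimensional.span_of_finite ℝ ((finite_multiIndex n k).image _)

/-- The orthogonal projection `Π_k` of `L²(γ)` onto the degree-`k` Hermite polynomials. -/
def hermiteProj (n k : ℕ) : L2 n →L[ℝ] L2 n := (hermiteSpace n k).starProjection

/-! ### Strategies and values -/

/-- A measurable function `ℝⁿ → {±1}`, regarded as real-valued. -/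
structure SignFunction (n : ℕ) where
  toFun : EuclideanSpace ℝ (Fin n) → ℝ
  measurable_toFun : Measurable toFun
  sign_values : ∀ x, toFun x = 1 ∨ toFun x = -1

instance (n : ℕ) : CoeFun (SignFunction n) (fun _ => EuclideanSpace ℝ (Fin n) → ℝ) :=
  ⟨SignFunction.toFun⟩

theorem SignFunction.memLp {n : ℕ} (f : SignFunction n) : MemLp f.toFun 2 (γ n) := by
  refine MemLp.of_bound f.measurable_toFun.aestronglyMeasurable 1 (Filter.Eventually.of_forall ?_)
  intro x
  rcases f.sign_values x with h | h <;> simp [h]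

/-- The class in `L²(γ)` of a `{±1}`-valued function. -/
def SignFunction.toL2 {n : ℕ} (f : SignFunction n) : L2 n := f.memLp.toLp f.toFun

/-- `val_A(f, g) = E_{X ∼ γ} (A f)(X) g(X)`. -/
def gameValue {n : ℕ} (A : L2 n →L[ℝ] L2 n) (f g : SignFunction n) : ℝ :=
  ∫ x, (A f.toL2 : EuclideanSpace ℝ (Fin n) → ℝ) x * g x ∂(γ n)

theorem gameValue_le {n : ℕ} (A : L2 n →L[ℝ] L2 n) (f g : SignFunction n) :
    gameValue A f g ≤ ‖A‖ * ‖f.toL2‖ * ‖g.toL2‖ := by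
  have h : gameValue A f g = inner ℝ g.toL2 (A f.toL2) := by
    rw [L2.inner_def]
    refine integral_congr_ae ?_
    filter_upwards [g.memLp.coeFn_toLp] with x hx
    simp [SignFunction.toL2, hx]
  rw [h]
  calc inner ℝ g.toL2 (A f.toL2) ≤ ‖g.toL2‖ * ‖A f.toL2‖ := real_inner_le_norm _ _
    _ ≤ ‖g.toL2‖ * (‖A‖ * ‖f.toL2‖) := by gcongr; exact A.le_opNorm _
    _ = ‖A‖ * ‖f.toL2‖ * ‖g.toL2‖ := by ring

theorem SignFunction.norm_toL2_le {n : ℕ} (f : SignFunction n) : ‖f.toL2‖ ≤ 1 := by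
  refine (Lp.norm_le_of_ae_bound (C := 1) zero_le_one ?_).trans (by simp [measureUnivNNReal])
  filter_upwards [f.memLp.coeFn_toLp] with x hx
  rw [SignFunction.toL2, hx]
  rcases f.sign_values x with h | h <;> simp [h]

/-- The supremum defining `val(A)` below is over a bounded set of real numbers. -/
theorem bddAbove_gameValue {n : ℕ} (A : L2 n →L[ℝ] L2 n) :
    BddAbove {r : ℝ | ∃ f g : SignFunction n, r = gameValue A f g} := by
  refine ⟨‖A‖, ?_⟩
  rintro r ⟨f, g, rfl⟩
  have h1 := f.norm_toL2_le
  have h2 := g.norm_toL2_le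
  calc gameValue A f g ≤ ‖A‖ * ‖f.toL2‖ * ‖g.toL2‖ := gameValue_le A f g
    _ ≤ ‖A‖ * 1 * 1 := by gcongr
    _ = ‖A‖ := by ring

/-- `val(A) = sup_{f, g : ℝⁿ → {±1}} val_A(f, g)`. -/
def val {n : ℕ} (A : L2 n →L[ℝ] L2 n) : ℝ :=
  sSup {r : ℝ | ∃ f g : SignFunction n, r = gameValue A f g}

/-- The Davie-Reeds operator `A_DR = Π₁ - λ* I` on `L²(γ)`. -/
def davieReeds (n : ℕ) : L2 n →L[ℝ] L2 n :=
  hermiteProj n 1 - lambdaStar • ContinuousLinearMap.id ℝ (L2 n)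

/-- The `L²(γ)` norm `‖h‖₂ = (E_{X ∼ γ} h(X)²)^{1/2}` of a function on `ℝⁿ`. -/
def gaussianNorm {n : ℕ} (h : EuclideanSpace ℝ (Fin n) → ℝ) : ℝ :=
  Real.sqrt (∫ x, h x ^ 2 ∂(γ n))

/-- `f, g` are Davie-Reeds strip functions: for some orthogonal map `T`, almost everywhere
`f ∘ T` and `g ∘ T` both equal `1` where `x₁ ≥ C*`, both equal `-1` where `x₁ ≤ -C*`, and are
negatives of each other where `-C* < x₁ < C*`. The first coordinate has index `0`. -/
def AreStripFunctions {n : ℕ} [NeZero n] (f g : SignFunction n) : Prop :=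
  ∃ T : EuclideanSpace ℝ (Fin n) ≃ₗᵢ[ℝ] EuclideanSpace ℝ (Fin n),
    ∀ᵐ x ∂(γ n),
      (CStar ≤ x 0 → f (T x) = 1 ∧ g (T x) = 1) ∧
      (-CStar < x 0 ∧ x 0 < CStar → f (T x) = -g (T x)) ∧
      (x 0 ≤ -CStar → f (T x) = -1 ∧ g (T x) = -1)

end

end DavieReeds

namespace DavieReeds

noncomputable section

/-! ### One-dimensional Gaussian integrals -/

/-! Put u = (f+g)/2 and w = (f-g)/2. Exactly one of u, w vanishes at each point, and the value
becomes ‖E[uX]‖² - ‖E[wX]‖² - 2λ* E|u| + λ* (`gameValue_davieReeds_eq`). The w-term only lowers it,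
so with θ the unit direction of E[uX], s = E[u⟨θ,X⟩] and q = E|u|, only s² - 2λ*q matters. Strip
functions that are even inside the strip have w-moment zero and bound `val` below by the same
expression at x = 2φ(C*), q₀ = 2Φ(-C*) (`le_val_davieReeds`).

Since λ* = xC*, expanding s² at x shows that the loss equals 2xD - (x-s)², where D = (x-s) -
C*(q₀-q). This D is the expected loss of u in the pointwise problem of maximizing ut - C*|u| over u
∈ {0, ±1}, t = ⟨θ,X⟩. The maximizer is `stripSign`, and any other choice costs at least ||t| - C*|
(`stripSign_deficit`). This cost is small only near t = ±C*, where the Gaussian density is bounded,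
so a set of measure m on which u is wrong forces D ≥ m²/(8φ(0)) (`sq_measureReal_ne_le`).

The quadratic error (x-s)² is absorbed numerically, using |q-q₀| ≤ m and C* < 3/10, which gives m² ≤
81η (`sq_le_of_deficit`). Where u agrees with `stripSign`, f and g already behave as strip
functions; correcting them elsewhere costs at most 4m in squared norm. -/

theorem integral_gaussianReal_eq (h : ℝ → ℝ) :
    ∫ x, h x ∂(gaussianReal 0 1) = ∫ x, gaussPDF x * h x := by
  rw [integral_gaussianReal_eq_integral_smul one_ne_zero, gaussPDF_eq]
  rfl

theorem tendsto_gaussPDF_atTop : Filter.Tendsto gaussPDF Filter.atTop (nhds 0) := by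
  have h : Filter.Tendsto (fun x : ℝ => -x ^ 2 / 2) Filter.atTop Filter.atBot := by
    have h1 : Filter.Tendsto (fun x : ℝ => x ^ 2 / 2) Filter.atTop Filter.atTop :=
      (Filter.tendsto_pow_atTop two_ne_zero).atTop_div_const two_pos
    refine (Filter.tendsto_neg_atTop_atBot.comp h1).congr fun x => ?_
    simp [neg_div]
  have h2 := (Real.tendsto_exp_atBot.comp h).const_mul (Real.sqrt (2 * Real.pi))⁻¹
  rw [mul_zero] at h2
  exact h2

theorem integrable_mul_gaussPDF : Integrable fun x : ℝ => x * gaussPDF x := by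
  have h := (integrable_mul_exp_neg_mul_sq (b := 1 / 2) (by norm_num)).const_mul
    (Real.sqrt (2 * Real.pi))⁻¹
  refine h.congr (Filter.Eventually.of_forall fun x => ?_)
  simp only [gaussPDF]
  rw [show -(1 / 2) * x ^ 2 = -x ^ 2 / 2 by ring]
  ring

theorem integral_Ioi_mul_gaussPDF (c : ℝ) : ∫ x in Set.Ioi c, x * gaussPDF x = gaussPDF c := by
  have h := integral_Ioi_of_hasDerivAt_of_tendsto' (a := c) (f := fun x => -gaussPDF x)
    (f' := fun x => x * gaussPDF x) (m := 0)
    (fun x _ => ((hasDerivAt_gaussPDF x).neg).congr_deriv (by ring))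
    integrable_mul_gaussPDF.integrableOn (by simpa using tendsto_gaussPDF_atTop.neg)
  simpa using h

theorem integral_Iic_mul_gaussPDF (c : ℝ) : ∫ x in Set.Iic (-c), -x * gaussPDF x = gaussPDF c := by
  rw [← integral_Ioi_mul_gaussPDF c, ← neg_neg c, ← integral_comp_neg_Iic, neg_neg]
  simp [gaussPDF_neg]

theorem integral_Ioi_gaussPDF (c : ℝ) : ∫ x in Set.Ioi c, gaussPDF x = gaussCDF (-c) := by
  rw [gaussCDF, ← neg_neg c, ← integral_comp_neg_Iic, neg_neg]
  simp [gaussPDF_neg]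

/-- The part `sgn(t) 1_{|t| ≥ c}` that strip functions of half-width `c` have in common. -/
def stripSign (c t : ℝ) : ℝ := if c ≤ t then 1 else if t ≤ -c then -1 else 0

theorem measurable_stripSign (c : ℝ) : Measurable (stripSign c) :=
  Measurable.ite measurableSet_Ici measurable_const
    (Measurable.ite measurableSet_Iic measurable_const measurable_const)

theorem abs_stripSign_le (c t : ℝ) : |stripSign c t| ≤ 1 := by
  unfold stripSign; split_ifs <;> simp

theorem integral_stripSign_mul {c : ℝ} (hc : 0 < c) :
    ∫ x, stripSign c x * x ∂(gaussianReal 0 1) = 2 * gaussPDF c := by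
  have h : ∀ x, gaussPDF x * (stripSign c x * x) =
      (Set.Ici c).indicator (fun x => x * gaussPDF x) x +
      (Set.Iic (-c)).indicator (fun x => -x * gaussPDF x) x := by
    intro x
    simp only [stripSign, Set.indicator_apply, Set.mem_Ici, Set.mem_Iic]
    split_ifs <;> first | (exfalso; linarith) | ring
  rw [integral_gaussianReal_eq, integral_congr_ae (Filter.Eventually.of_forall h), integral_add
    (integrable_mul_gaussPDF.indicator measurableSet_Ici)
    ((integrable_mul_gaussPDF.neg.congr (Filter.Eventually.of_forall fun x => by simp)).indicator
      measurableSet_Iic),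
    integral_indicator measurableSet_Ici, integral_indicator measurableSet_Iic,
    integral_Ici_eq_integral_Ioi, integral_Ioi_mul_gaussPDF, integral_Iic_mul_gaussPDF]
  ring

theorem integral_abs_stripSign {c : ℝ} (hc : 0 < c) :
    ∫ x, |stripSign c x| ∂(gaussianReal 0 1) = 2 * gaussCDF (-c) := by
  have h : ∀ x, gaussPDF x * |stripSign c x| =
      (Set.Ici c).indicator gaussPDF x + (Set.Iic (-c)).indicator gaussPDF x := by
    intro x
    simp only [stripSign, Set.indicator_apply, Set.mem_Ici, Set.mem_Iic]
    split_ifs <;> first | (exfalso; linarith) | simp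
  rw [integral_gaussianReal_eq, integral_congr_ae (Filter.Eventually.of_forall h), integral_add
    (integrable_gaussPDF.indicator measurableSet_Ici)
    (integrable_gaussPDF.indicator measurableSet_Iic),
    integral_indicator measurableSet_Ici, integral_indicator measurableSet_Iic,
    integral_Ici_eq_integral_Ioi, integral_Ioi_gaussPDF, ← gaussCDF]
  ring

theorem gaussPDF_le_zero (x : ℝ) : gaussPDF x ≤ gaussPDF 0 := by
  unfold gaussPDF
  refine mul_le_mul_of_nonneg_left (Real.exp_le_exp.2 ?_) (by positivity)
  nlinarith [sq_nonneg x]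

theorem integral_tent {T : ℝ} (hT : 0 ≤ T) (c : ℝ) :
    Integrable (fun x : ℝ => max (T - |x - c|) 0) ∧ ∫ x, max (T - |x - c|) 0 = T ^ 2 := by
  have hc : Continuous fun x : ℝ => max (T - |x|) 0 := by fun_prop
  have hs : ∀ x ∉ Set.Icc (-T) T, max (T - |x|) 0 = 0 := by
    intro x hx
    rw [Set.mem_Icc, ← abs_le, not_le] at hx
    exact max_eq_right (by linarith)
  have hi : Integrable fun x : ℝ => max (T - |x|) 0 :=
    hc.integrable_of_hasCompactSupport (HasCompactSupport.intro isCompact_Icc hs)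
  refine ⟨hi.comp_sub_right c, ?_⟩
  rw [integral_sub_right_eq_self (fun x : ℝ => max (T - |x|) 0) c,
    integral_comp_abs (f := fun x => max (T - x) 0)]
  have h1 : ∫ x in Set.Ioi (0 : ℝ), max (T - x) 0 = ∫ x in Set.Ioc (0 : ℝ) T, (T - x) := by
    rw [setIntegral_eq_of_subset_of_forall_sdiff_eq_zero measurableSet_Ioi
      (show Set.Ioc 0 T ⊆ Set.Ioi 0 from Set.Ioc_subset_Ioi_self)]
    · exact setIntegral_congr_fun measurableSet_Ioc fun x hx => max_eq_left (by linarith [hx.2])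
    · intro x hx
      have h0 : 0 < x := hx.1
      have : ¬ x ≤ T := fun h => hx.2 ⟨h0, h⟩
      exact max_eq_right (by linarith)
  rw [h1, ← intervalIntegral.integral_of_le hT, intervalIntegral.integral_sub (by simp) (by simp),
    integral_id, intervalIntegral.integral_const, smul_eq_mul]
  ring

/-- The integrand is dominated by the tents of height T at c and -c, each of area T², and the
density is at most φ(0). -/
theorem integral_tent_strip_le {T c : ℝ} (hT : 0 ≤ T) :
    ∫ x, max (T - |(|x| - c)|) 0 ∂(gaussianReal 0 1) ≤ 2 * gaussPDF 0 * T ^ 2 := by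
  obtain ⟨i1, e1⟩ := integral_tent hT c
  obtain ⟨i2, e2⟩ := integral_tent hT (-c)
  rw [integral_gaussianReal_eq]
  calc ∫ x, gaussPDF x * max (T - |(|x| - c)|) 0
      ≤ ∫ x, gaussPDF 0 * (max (T - |x - c|) 0 + max (T - |x - -c|) 0) := by
        refine integral_mono_of_nonneg (Filter.Eventually.of_forall fun x => ?_)
          ((i1.add i2).const_mul _) (Filter.Eventually.of_forall fun x => ?_)
        · exact mul_nonneg (gaussPDF_pos x).le (le_max_right _ _)
        · refine mul_le_mul (gaussPDF_le_zero x) ?_ (le_max_right _ _) (gaussPDF_pos 0).le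
          have h1 := le_max_right (T - |x - c|) 0
          have h2 := le_max_right (T - |x - -c|) 0
          rcases le_total 0 x with hx | hx
          · rw [abs_of_nonneg hx]; linarith
          · rw [abs_of_nonpos hx, show -x - c = -(x - -c) by ring, abs_neg]; linarith
    _ = 2 * gaussPDF 0 * T ^ 2 := by
        rw [integral_const_mul, integral_add i1 i2, e1, e2]; ring

/-! ### Numerical bounds on the constants -/

theorem gaussPDF_zero_le : gaussPDF 0 ≤ 2 / 5 := by
  have h2 : (5 / 2 : ℝ) ≤ Real.sqrt (2 * Real.pi) := by
    apply Real.le_sqrt_of_sq_le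
    nlinarith [Real.pi_gt_d2]
  have h3 : (Real.sqrt (2 * Real.pi))⁻¹ ≤ (5 / 2 : ℝ)⁻¹ := inv_anti₀ (by norm_num) h2
  norm_num at h3
  simpa [gaussPDF] using h3

theorem le_gaussPDF {x : ℝ} (hx0 : 0 ≤ x) (hx : x ≤ 3 / 10) : 189 / 500 ≤ gaussPDF x := by
  have h2 : Real.sqrt (2 * Real.pi) ≤ 2.51 := by
    rw [Real.sqrt_le_left (by norm_num)]
    nlinarith [Real.pi_lt_d2]
  have h3 : (2.51 : ℝ)⁻¹ ≤ (Real.sqrt (2 * Real.pi))⁻¹ := inv_anti₀ (by positivity) h2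
  have h4 : (0.955 : ℝ) ≤ Real.exp (-x ^ 2 / 2) := by
    have := Real.add_one_le_exp (-x ^ 2 / 2)
    nlinarith
  have h5 := mul_le_mul h3 h4 (by norm_num) (by positivity)
  unfold gaussPDF
  norm_num at h5 ⊢
  linarith

/-- `criticalFun` increases on [0,1], so it suffices that it is positive at 3/10. There it equals
4φ(3/10)² + 4∫φ - 1 with the integral over [-3/10, 0], and φ ≥ 0.378 on that interval makes this
positive. -/
theorem CStar_lt : CStar < 3 / 10 := by
  obtain ⟨h0, h1, hC⟩ := CStar_spec
  by_contra! h
  have hm := strictMonoOn_criticalFun.monotoneOn (a := 3 / 10) (b := CStar)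
    ⟨by norm_num, by norm_num⟩ ⟨h0.le, h1.le⟩ h
  have hz : criticalFun CStar = 0 := hC
  have e1 : gaussCDF 0 - gaussCDF (-(3 / 10)) = ∫ t in (-(3 / 10) : ℝ)..0, gaussPDF t :=
    intervalIntegral.integral_Iic_sub_Iic integrable_gaussPDF.integrableOn
      integrable_gaussPDF.integrableOn
  have e2 : ∫ _t in (-(3 / 10) : ℝ)..0, (189 / 500 : ℝ) ≤ ∫ t in (-(3 / 10) : ℝ)..0, gaussPDF t := by
    apply intervalIntegral.integral_mono_on (by norm_num) (by simp)
      (continuous_gaussPDF.intervalIntegrable _ _)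
    intro x hx
    rw [← gaussPDF_neg]
    exact le_gaussPDF (by linarith [hx.2]) (by linarith [hx.1])
  rw [intervalIntegral.integral_const] at e2
  norm_num at e2
  rw [gaussCDF_zero] at e1
  have e3 := le_gaussPDF (x := 3 / 10) (by norm_num) le_rfl
  rw [hz] at hm
  unfold criticalFun at hm
  nlinarith

/-- The loss is 2xD - (x-s)². For s near x the linear term dominates the square; for s far below x
the loss is bounded below by a constant, and m ≤ 1 suffices. -/
theorem sq_le_of_deficit_aux {x C q₀ s q m η D : ℝ} (hC0 : 0 < C) (hC : C < 3 / 10)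
    (hx1 : x ≤ 4 / 5) (hx2 : 3 / 4 ≤ x) (hq₀ : q₀ ≤ 41 / 50) (hs : 0 ≤ s) (hq : 0 ≤ q)
    (hm0 : 0 ≤ m) (hm1 : m ≤ 1) (hqa : q₀ - q ≤ m) (hqb : q - q₀ ≤ m)
    (hDD : D = x - s - C * (q₀ - q)) (hD1 : m ^ 2 ≤ 16 / 5 * D)
    (hη : x ^ 2 - 2 * (x * C) * q₀ - (s ^ 2 - 2 * (x * C) * q) ≤ η) : m ^ 2 ≤ 81 * η := by
  have hD0 : 0 ≤ D := by linarith [sq_nonneg m]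
  rcases le_total (2 / 5) (x - s) with hd | hd
  -- Far case: x² - s² ≥ 0.44, while the mass term recovers at most 2·0.24·0.82 < 0.394, so η >
  -- 0.046 and 81η > 1 ≥ m².
  · have h1 : 2 / 5 * (3 / 2 - 2 / 5) ≤ (x - s) * (x + s) := by
      have : 0 ≤ (x - s - 2 / 5) * s := mul_nonneg (by linarith) hs
      nlinarith
    have h2 : x * C ≤ 4 / 5 * (3 / 10) := mul_le_mul hx1 hC.le hC0.le (by norm_num)
    have h0 : 0 ≤ x * C := by positivity
    have h3 : x * C * (q₀ - q) ≤ x * C * (41 / 50) :=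
      mul_le_mul_of_nonneg_left (by linarith) h0
    have h4 : m ^ 2 ≤ 1 := pow_le_one₀ hm0 hm1
    linarith
  · have hη' : 2 * x * D - (x - s) ^ 2 ≤ η := by
      refine le_trans (le_of_eq ?_) hη
      rw [hDD]; ring
    have hCC : C ^ 2 ≤ 9 / 100 := by
      have := pow_le_pow_left₀ hC0.le hC.le 2
      norm_num at this
      exact this
    have hCm : (C * m) ^ 2 ≤ 9 / 100 * (16 / 5 * D) := by
      rw [mul_pow]
      exact mul_le_mul hCC hD1 (sq_nonneg _) (by norm_num)
    have hxD : 3 / 2 * D ≤ 2 * x * D := mul_le_mul_of_nonneg_right (by linarith) hD0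
    -- The factor 7/5 stays below the 3/2 of `hxD`, leaving D/10 ≤ η and hence m² ≤ 32η.
    have hd2 : (x - s) ^ 2 ≤ 7 / 5 * D := by
      rcases le_total 0 (q₀ - q) with hδ | hδ
      · have hCδ : 0 ≤ C * (q₀ - q) := by positivity
        have hCδ' : C * (q₀ - q) ≤ C * m := mul_le_mul_of_nonneg_left hqa hC0.le
        have e : x - s = D + C * (q₀ - q) := by linarith
        have h4 : (C * (q₀ - q)) ^ 2 ≤ (C * m) ^ 2 := pow_le_pow_left₀ hCδ hCδ' 2
        have h5 : D * D ≤ 2 / 5 * D := mul_le_mul_of_nonneg_right (by linarith) hD0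
        rw [e]
        -- (a+b)² ≤ 2a² + 2b² gives the factor 2·0.4 + 2·0.288 = 1.376.
        linarith [sq_nonneg (D - C * (q₀ - q))]
      · have hCδ : 0 ≤ C * (q - q₀) := mul_nonneg hC0.le (by linarith)
        have hCδ' : C * (q - q₀) ≤ C * m := mul_le_mul_of_nonneg_left hqb hC0.le
        have e : x - s = D - C * (q - q₀) := by linarith
        rcases le_total 0 (x - s) with h | h
        · have : (x - s) * (x - s) ≤ 2 / 5 * D := mul_le_mul hd (by linarith) h (by norm_num)
          linarith
        · have : (s - x) ^ 2 ≤ (C * m) ^ 2 :=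
            pow_le_pow_left₀ (by linarith) (by linarith) 2
          linarith
    linarith

/-- The scalar inequality behind stability: `s`, `q` are the first moment and the mass of
`(f + g) / 2`, and `m` is the measure of the set where it differs from `stripSign C*`. -/
theorem sq_le_of_deficit {s q m η : ℝ} (hs : 0 ≤ s) (hq : 0 ≤ q) (hm0 : 0 ≤ m) (hm1 : m ≤ 1)
    (hqm : |q - 2 * gaussCDF (-CStar)| ≤ m)
    (hD : m ^ 2 ≤ 8 * gaussPDF 0 * (2 * gaussPDF CStar - s
      - CStar * (2 * gaussCDF (-CStar) - q)))
    (hη : ((2 * gaussPDF CStar) ^ 2 - 2 * lambdaStar * (2 * gaussCDF (-CStar)))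
      - (s ^ 2 - 2 * lambdaStar * q) ≤ η) : m ^ 2 ≤ 81 * η := by
  obtain ⟨hC0, -, hC⟩ := CStar_spec
  have hC3 := CStar_lt
  have hp := gaussPDF_zero_le
  have hp1 := (gaussPDF_le_zero CStar).trans hp
  have hp2 := le_gaussPDF hC0.le hC3.le
  have h0 := gaussPDF_pos 0
  obtain ⟨hqa, hqb⟩ := abs_le.1 hqm
  have hl : lambdaStar = 2 * gaussPDF CStar * CStar := by unfold lambdaStar; ring
  rw [hl] at hη
  refine sq_le_of_deficit_aux hC0 hC3 (x := 2 * gaussPDF CStar) (by linarith) (by linarith) ?_ hs hq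
    hm0 hm1 (by linarith) hqb rfl (hD.trans ?_) hη
  -- The equation defining C* turns 2Φ(-C*) into 2φ(C*)² + 1/2 ≤ 2·0.16 + 0.5 = 0.82.
  · have := pow_le_pow_left₀ (gaussPDF_pos CStar).le hp1 2
    linarith
  · refine mul_le_mul_of_nonneg_right (by linarith) ?_
    exact nonneg_of_mul_nonneg_right ((sq_nonneg m).trans hD) (by positivity)

/-! ### First moments and the degree-one Hermite projection -/

theorem measurePreserving_inner {n : ℕ} {θ : EuclideanSpace ℝ (Fin n)} (hθ : ‖θ‖ = 1) :
    MeasurePreserving (fun x => inner ℝ θ x) (γ n) (gaussianReal 0 1) := by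
  refine ⟨by fun_prop, ?_⟩
  have h := IsGaussian.map_eq_gaussianReal (μ := γ n) (innerSL ℝ θ)
  rw [integral_strongDual_stdGaussian, variance_dual_stdGaussian, innerSL_apply_norm, hθ] at h
  simpa using! h

theorem integrable_id_gamma (n : ℕ) :
    Integrable (fun x : EuclideanSpace ℝ (Fin n) => x) (γ n) :=
  IsGaussian.integrable_id

theorem integrable_of_abs_le_one {n : ℕ} {u : EuclideanSpace ℝ (Fin n) → ℝ} (hu : Measurable u)
    (hb : ∀ x, |u x| ≤ 1) : Integrable u (γ n) :=
  Integrable.of_bound hu.aestronglyMeasurable 1 (Filter.Eventually.of_forall hb)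

theorem integrable_smul_id {n : ℕ} {u : EuclideanSpace ℝ (Fin n) → ℝ} (hu : Measurable u)
    (hb : ∀ x, |u x| ≤ 1) : Integrable (fun x => u x • x) (γ n) :=
  (integrable_id_gamma n).bdd_smul 1 hu.aestronglyMeasurable (Filter.Eventually.of_forall hb)

/-- The vector `E[u(X) X]`. -/
def firstMoment {n : ℕ} (u : EuclideanSpace ℝ (Fin n) → ℝ) : EuclideanSpace ℝ (Fin n) :=
  ∫ x, u x • x ∂(γ n)

theorem integrable_mul_inner {n : ℕ} {u : EuclideanSpace ℝ (Fin n) → ℝ} (hu : Measurable u)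
    (hb : ∀ x, |u x| ≤ 1) (θ : EuclideanSpace ℝ (Fin n)) :
    Integrable (fun x => u x * inner ℝ θ x) (γ n) := by
  simpa [inner_smul_right] using (integrable_smul_id hu hb).const_inner (𝕜 := ℝ) θ

theorem inner_firstMoment {n : ℕ} {u : EuclideanSpace ℝ (Fin n) → ℝ} (hu : Measurable u)
    (hb : ∀ x, |u x| ≤ 1) (θ : EuclideanSpace ℝ (Fin n)) :
    inner ℝ θ (firstMoment u) = ∫ x, u x * inner ℝ θ x ∂(γ n) := by
  rw [firstMoment, ← integral_inner (integrable_smul_id hu hb)]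
  simp [inner_smul_right]

theorem firstMoment_add {n : ℕ} {u v : EuclideanSpace ℝ (Fin n) → ℝ} (hu : Measurable u)
    (hbu : ∀ x, |u x| ≤ 1) (hv : Measurable v) (hbv : ∀ x, |v x| ≤ 1) :
    firstMoment (fun x => u x + v x) = firstMoment u + firstMoment v := by
  simp only [firstMoment, add_smul]
  exact integral_add (integrable_smul_id hu hbu) (integrable_smul_id hv hbv)

theorem firstMoment_sub {n : ℕ} {u v : EuclideanSpace ℝ (Fin n) → ℝ} (hu : Measurable u)
    (hbu : ∀ x, |u x| ≤ 1) (hv : Measurable v) (hbv : ∀ x, |v x| ≤ 1) :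
    firstMoment (fun x => u x - v x) = firstMoment u - firstMoment v := by
  simp only [firstMoment, sub_smul]
  exact integral_sub (integrable_smul_id hu hbu) (integrable_smul_id hv hbv)

/-- The first moment of an even function vanishes. -/
theorem firstMoment_of_even {n : ℕ} {u : EuclideanSpace ℝ (Fin n) → ℝ}
    (hu : ∀ x, u (-x) = u x) : firstMoment u = 0 := by
  have h : firstMoment u = -firstMoment u := by
    have hm := stdGaussian_map (LinearIsometryEquiv.neg ℝ (E := EuclideanSpace ℝ (Fin n)))
    conv_lhs => rw [firstMoment, γ, ← hm]
    have he : MeasurableEmbedding (LinearIsometryEquiv.neg ℝ (E := EuclideanSpace ℝ (Fin n))) :=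
      (LinearIsometryEquiv.neg ℝ).toHomeomorph.measurableEmbedding
    rw [he.integral_map]
    simp [hu, integral_neg, firstMoment]
  have h2 : (2 : ℝ) • firstMoment u = 0 := by
    rw [two_smul]
    exact add_eq_zero_iff_eq_neg.2 h
  exact (smul_eq_zero.1 h2).resolve_left two_ne_zero

theorem SignFunction.abs_le {n : ℕ} (f : SignFunction n) (x : EuclideanSpace ℝ (Fin n)) :
    |f x| ≤ 1 := by
  rcases f.sign_values x with h | h <;> simp [h]

theorem hermiteL2_single {n : ℕ} (i : Fin n) :
    hermiteL2 (Pi.single i 1) =ᵐ[γ n] fun x => x i := by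
  refine (MemLp.coeFn_toLp _).trans (Filter.Eventually.of_forall fun x => ?_)
  simp only [hermiteFun]
  rw [Finset.prod_eq_single i]
  · simp
  · intro j _ hj
    simp [Pi.single_eq_of_ne hj]
  · simp

theorem hermiteSpace_one (n : ℕ) :
    hermiteSpace n 1 = Submodule.span ℝ (Set.range fun i : Fin n => hermiteL2 (Pi.single i 1)) := by
  rw [hermiteSpace]
  congr 1
  ext v
  constructor
  · rintro ⟨α, hα, rfl⟩
    obtain ⟨i, hi⟩ : ∃ i, α = Pi.single i 1 := by
      have hα' : ∑ i, α i = 1 := hα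
      obtain ⟨i, -, hi⟩ := Finset.exists_ne_zero_of_sum_ne_zero (hα'.trans_ne one_ne_zero)
      refine ⟨i, funext fun j => ?_⟩
      have hs := Finset.add_sum_erase Finset.univ α (Finset.mem_univ i)
      have h0 : ∑ j ∈ Finset.univ.erase i, α j = 0 := by omega
      rcases eq_or_ne j i with rfl | hj
      · simp; omega
      · rw [Pi.single_eq_of_ne hj]
        exact Finset.sum_eq_zero_iff.1 h0 j (by simp [hj])
    exact ⟨i, by rw [hi]⟩
  · rintro ⟨i, rfl⟩
    exact ⟨Pi.single i 1, by simp, rfl⟩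

theorem integral_coord_mul_coord {n : ℕ} (i j : Fin n) :
    ∫ x, x i * x j ∂(γ n) = if i = j then 1 else 0 := by
  have h := covariance_eval_multivariateGaussian (ι := Fin n) (μ := 0) Matrix.PosSemidef.one i j
  rw [multivariateGaussian_zero_one, covariance_eq_sub (by simpa using AllMoments.coord i 2)
    (by simpa using AllMoments.coord j 2)] at h
  have h0 : ∀ k : Fin n, ∫ x, x k ∂(γ n) = 0 := fun k =>
    integral_strongDual_stdGaussian (EuclideanSpace.proj k)
  simpa [h0, Matrix.one_apply] using! h

theorem inner_hermiteL2_single {n : ℕ} (i j : Fin n) :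
    inner ℝ (hermiteL2 (Pi.single i 1)) (hermiteL2 (n := n) (Pi.single j 1)) =
      if i = j then (1 : ℝ) else 0 := by
  rw [L2.inner_def, ← integral_coord_mul_coord]
  refine integral_congr_ae ?_
  filter_upwards [hermiteL2_single i, hermiteL2_single j] with x hi hj
  simp [hi, hj, mul_comm]

theorem inner_hermiteL2_toL2 {n : ℕ} (i : Fin n) (f : SignFunction n) :
    inner ℝ (hermiteL2 (Pi.single i 1)) f.toL2 = firstMoment f i := by
  have h := inner_firstMoment f.measurable_toFun f.abs_le (EuclideanSpace.single i 1)
  simp only [EuclideanSpace.inner_single_left, map_one, one_mul] at h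
  rw [h, L2.inner_def]
  refine integral_congr_ae ?_
  filter_upwards [hermiteL2_single i, f.memLp.coeFn_toLp] with x hi hj
  simp [hi, SignFunction.toL2, hj]

/-- The degree-one Hermite polynomials are the coordinate functions, which are orthonormal under γ.
-/
theorem hermiteProj_one_apply {n : ℕ} (h : L2 n) :
    hermiteProj n 1 h = ∑ i : Fin n, (inner ℝ (hermiteL2 (Pi.single i 1)) h : ℝ) •
      hermiteL2 (n := n) (Pi.single i 1) := by
  refine Submodule.eq_starProjection_of_mem_of_inner_eq_zero ?_ ?_
  · rw [hermiteSpace_one]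
    exact Submodule.sum_mem _ fun i _ => Submodule.smul_mem _ _ (Submodule.subset_span ⟨i, rfl⟩)
  · rw [hermiteSpace_one]
    intro w hw
    induction hw using Submodule.span_induction with
    | mem w hw =>
      obtain ⟨j, rfl⟩ := hw
      simp [inner_sub_left, sum_inner, inner_smul_left, inner_hermiteL2_single,
        real_inner_comm h]
    | zero => simp
    | add x y _ _ hx hy => rw [inner_add_right, hx, hy, add_zero]
    | smul c x _ hx => rw [inner_smul_right, hx, mul_zero]

theorem gameValue_eq_inner {n : ℕ} (A : L2 n →L[ℝ] L2 n) (f g : SignFunction n) :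
    gameValue A f g = inner ℝ g.toL2 (A f.toL2) := by
  rw [L2.inner_def]
  refine integral_congr_ae ?_
  filter_upwards [g.memLp.coeFn_toLp] with x hx
  simp [SignFunction.toL2, hx]

theorem gameValue_davieReeds {n : ℕ} (f g : SignFunction n) :
    gameValue (davieReeds n) f g =
      inner ℝ (firstMoment f) (firstMoment g) - lambdaStar * ∫ x, f x * g x ∂(γ n) := by
  have h1 : inner ℝ g.toL2 (hermiteProj n 1 f.toL2) =
      inner ℝ (firstMoment f.toFun) (firstMoment g.toFun) := by
    rw [hermiteProj_one_apply, inner_sum, PiLp.inner_apply]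
    refine Finset.sum_congr rfl fun i _ => ?_
    rw [inner_smul_right, real_inner_comm _ g.toL2, inner_hermiteL2_toL2, inner_hermiteL2_toL2]
    simp [mul_comm]
  have h2 : inner ℝ g.toL2 f.toL2 = ∫ x, f x * g x ∂(γ n) := by
    rw [L2.inner_def]
    refine integral_congr_ae ?_
    filter_upwards [f.memLp.coeFn_toLp, g.memLp.coeFn_toLp] with x hf hg
    simp [SignFunction.toL2, hf, hg]
  rw [gameValue_eq_inner, davieReeds]
  simp only [sub_apply, smul_apply,
    ContinuousLinearMap.id_apply, inner_sub_right, inner_smul_right, h1, h2]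

/-- The value in terms of the half-sum and half-difference of the two functions. -/
theorem gameValue_davieReeds_eq {n : ℕ} (f g : SignFunction n) :
    gameValue (davieReeds n) f g =
      ‖firstMoment fun x => (f x + g x) / 2‖ ^ 2 - ‖firstMoment fun x => (f x - g x) / 2‖ ^ 2
        - 2 * lambdaStar * ∫ x, |(f x + g x) / 2| ∂(γ n) + lambdaStar := by
  have half : ∀ u : EuclideanSpace ℝ (Fin n) → ℝ,
      firstMoment (fun x => u x / 2) = (1 / 2 : ℝ) • firstMoment u := by
    intro u
    rw [firstMoment, firstMoment, ← integral_smul]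
    refine integral_congr_ae (Filter.Eventually.of_forall fun x => ?_)
    simp only [smul_smul]
    congr 1
    ring
  have hI : ∫ x, f x * g x ∂(γ n) = 2 * (∫ x, |(f x + g x) / 2| ∂(γ n)) - 1 := by
    have hi : Integrable (fun x => |(f x + g x) / 2|) (γ n) := by
      refine integrable_of_abs_le_one
        ((f.measurable_toFun.add g.measurable_toFun).div_const 2).abs fun x => ?_
      rcases f.sign_values x with h | h <;> rcases g.sign_values x with h' | h' <;> simp [h, h']
    have e : ∀ x, f x * g x = 2 * |(f x + g x) / 2| - 1 := by
      intro x
      rcases f.sign_values x with h | h <;> rcases g.sign_values x with h' | h' <;>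
        norm_num [h, h']
    rw [integral_congr_ae (Filter.Eventually.of_forall e), integral_sub (hi.const_mul 2)
      (integrable_const _), integral_const_mul]
    simp
  rw [gameValue_davieReeds, hI, half, half,
    firstMoment_add f.measurable_toFun f.abs_le g.measurable_toFun g.abs_le,
    firstMoment_sub f.measurable_toFun f.abs_le g.measurable_toFun g.abs_le,
    norm_smul, norm_smul, mul_pow, mul_pow, norm_add_sq_real, norm_sub_sq_real]
  norm_num
  ring

/-! ### Strip functions -/

/-- The sign function equal to `stripSign C*` of the coordinate along `θ` outside the strip, and
to `h` inside it. -/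
def stripModification {n : ℕ} (θ : EuclideanSpace ℝ (Fin n)) (h : SignFunction n) :
    SignFunction n where
  toFun x := if CStar ≤ inner ℝ θ x then 1 else if inner ℝ θ x ≤ -CStar then -1 else h x
  measurable_toFun := by
    have hm : Measurable fun x : EuclideanSpace ℝ (Fin n) => (inner ℝ θ x : ℝ) := by fun_prop
    exact Measurable.ite (measurableSet_le measurable_const hm) measurable_const
      (Measurable.ite (measurableSet_le hm measurable_const) measurable_const h.measurable_toFun)
  sign_values x := by
    have := h.sign_values x
    split_ifs <;> simp [this]

/-- The pointwise negative of a sign function. -/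
def SignFunction.neg {n : ℕ} (h : SignFunction n) : SignFunction n where
  toFun x := -h x
  measurable_toFun := h.measurable_toFun.neg
  sign_values x := by rcases h.sign_values x with hx | hx <;> simp [hx]

/-- The constant sign function `1`. -/
def SignFunction.one (n : ℕ) : SignFunction n where
  toFun _ := 1
  measurable_toFun := measurable_const
  sign_values _ := Or.inl rfl

/-- The reflection in the hyperplane orthogonal to e₀ - θ maps e₀ to θ, so it turns ⟨θ, ·⟩ into the
first coordinate. -/
theorem exists_linearIsometryEquiv_inner {n : ℕ} [NeZero n] {θ : EuclideanSpace ℝ (Fin n)}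
    (hθ : ‖θ‖ = 1) : ∃ T : EuclideanSpace ℝ (Fin n) ≃ₗᵢ[ℝ] EuclideanSpace ℝ (Fin n),
      ∀ x, inner ℝ θ (T x) = x 0 := by
  have hn : ‖EuclideanSpace.single (0 : Fin n) (1 : ℝ)‖ = ‖θ‖ := by simp [hθ]
  refine ⟨Submodule.reflection (ℝ ∙ (EuclideanSpace.single (0 : Fin n) (1 : ℝ) - θ))ᗮ, fun x => ?_⟩
  have h := LinearIsometryEquiv.inner_map_map
    (Submodule.reflection (ℝ ∙ (EuclideanSpace.single (0 : Fin n) (1 : ℝ) - θ))ᗮ)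
    (EuclideanSpace.single 0 1) x
  rw [Submodule.reflection_sub hn] at h
  rw [h, EuclideanSpace.inner_single_left]
  simp

theorem areStripFunctions_stripModification {n : ℕ} [NeZero n] {θ : EuclideanSpace ℝ (Fin n)}
    (hθ : ‖θ‖ = 1) (h : SignFunction n) :
    AreStripFunctions (stripModification θ h) (stripModification θ h.neg) := by
  obtain ⟨T, hT⟩ := exists_linearIsometryEquiv_inner hθ
  have hC := CStar_spec.1
  refine ⟨T, Filter.Eventually.of_forall fun x => ?_⟩
  simp only [stripModification, hT]
  refine ⟨fun h1 => by simp [h1], fun h1 => ?_, fun h1 => ?_⟩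
  · rw [if_neg (by linarith), if_neg (by linarith), if_neg (by linarith), if_neg (by linarith)]
    simp [SignFunction.neg]
  · rw [if_neg (by linarith), if_pos h1, if_neg (by linarith), if_pos h1]
    simp

theorem integral_stripSign_inner_mul {n : ℕ} {θ : EuclideanSpace ℝ (Fin n)} (hθ : ‖θ‖ = 1) {c : ℝ}
    (hc : 0 < c) :
    ∫ x, stripSign c (inner ℝ θ x) * inner ℝ θ x ∂(γ n) = 2 * gaussPDF c := by
  rw [← integral_stripSign_mul hc, ← (measurePreserving_inner hθ).map_eq,
    integral_map (by fun_prop)]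
  exact ((measurable_stripSign c).mul measurable_id).aestronglyMeasurable

theorem integral_abs_stripSign_inner {n : ℕ} {θ : EuclideanSpace ℝ (Fin n)} (hθ : ‖θ‖ = 1) {c : ℝ}
    (hc : 0 < c) :
    ∫ x, |stripSign c (inner ℝ θ x)| ∂(γ n) = 2 * gaussCDF (-c) := by
  rw [← integral_abs_stripSign hc, ← (measurePreserving_inner hθ).map_eq,
    integral_map (by fun_prop)]
  exact (measurable_stripSign c).abs.aestronglyMeasurable

theorem integral_tent_inner_le {n : ℕ} {θ : EuclideanSpace ℝ (Fin n)} (hθ : ‖θ‖ = 1) {T c : ℝ}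
    (hT : 0 ≤ T) :
    ∫ x, max (T - |(|inner ℝ θ x| - c)|) 0 ∂(γ n) ≤ 2 * gaussPDF 0 * T ^ 2 := by
  refine le_trans (le_of_eq ?_) (integral_tent_strip_le (c := c) hT)
  rw [← (measurePreserving_inner hθ).map_eq, integral_map (by fun_prop)]
  exact Continuous.aestronglyMeasurable (by fun_prop)

/-- A lower bound for the value, attained by strip functions that are even on the strip. -/
theorem le_val_davieReeds (n : ℕ) [NeZero n] :
    (2 * gaussPDF CStar) ^ 2 - 2 * lambdaStar * (2 * gaussCDF (-CStar)) + lambdaStar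
      ≤ val (davieReeds n) := by
  set θ : EuclideanSpace ℝ (Fin n) := EuclideanSpace.single 0 1
  have hθ : ‖θ‖ = 1 := by simp [θ]
  have hC := CStar_spec.1
  set f := stripModification θ (SignFunction.one n)
  set g := stripModification θ (SignFunction.one n).neg
  have e1 : ∀ x, (f x + g x) / 2 = stripSign CStar (inner ℝ θ x) := by
    intro x
    simp only [f, g, stripModification, SignFunction.one, SignFunction.neg, stripSign]
    split_ifs <;> norm_num
  -- The half-difference is the indicator of the open strip, an even function.
  have e2 : (firstMoment fun x => (f x - g x) / 2) = 0 := by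
    refine firstMoment_of_even fun x => ?_
    simp only [f, g, stripModification, SignFunction.one, SignFunction.neg, inner_neg_right]
    split_ifs <;> first | (exfalso; linarith) | norm_num
  have h1 : gameValue (davieReeds n) f g ≤ val (davieReeds n) :=
    le_csSup (bddAbove_gameValue _) ⟨f, g, rfl⟩
  refine le_trans ?_ h1
  have hm : Measurable fun x : EuclideanSpace ℝ (Fin n) => stripSign CStar (inner ℝ θ x) :=
    (measurable_stripSign _).comp (by fun_prop)
  have h2 := inner_firstMoment hm (fun x => abs_stripSign_le _ _) θ
  rw [integral_stripSign_inner_mul hθ hC] at h2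
  -- Only a lower bound on the norm is needed, so its component along θ suffices.
  have h3 := real_inner_le_norm θ (firstMoment fun x => stripSign CStar (inner ℝ θ x))
  rw [hθ, one_mul, h2] at h3
  have h4 := pow_le_pow_left₀ (by linarith [gaussPDF_pos CStar]) h3 2
  rw [gameValue_davieReeds_eq, e2]
  simp only [e1]
  rw [integral_abs_stripSign_inner hθ hC]
  simp only [norm_zero]
  linarith

/-! ### Stability -/

theorem exists_unit_inner_eq_norm {n : ℕ} [NeZero n] (p : EuclideanSpace ℝ (Fin n)) :
    ∃ θ : EuclideanSpace ℝ (Fin n), ‖θ‖ = 1 ∧ inner ℝ θ p = ‖p‖ := by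
  by_cases hp : p = 0
  · exact ⟨EuclideanSpace.single 0 1, by simp, by simp [hp]⟩
  · have hp' : ‖p‖ ≠ 0 := norm_ne_zero_iff.2 hp
    refine ⟨‖p‖⁻¹ • p, by simp [norm_smul, hp'], ?_⟩
    rw [inner_smul_left, real_inner_self_eq_norm_sq]
    simp
    field_simp

/-- Pointwise optimality of `stripSign c t` for the functional `u ↦ u t - c |u|`. -/
theorem stripSign_deficit {c t u : ℝ} (hc : 0 < c) (hu : u = 1 ∨ u = -1 ∨ u = 0) :
    (if u ≠ stripSign c t then |(|t| - c)| else 0) ≤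
      (stripSign c t * t - u * t) - c * (|stripSign c t| - |u|) := by
  unfold stripSign
  rcases abs_cases t with ⟨h1, h2⟩ | ⟨h1, h2⟩ <;> rw [h1] <;>
  rcases hu with rfl | rfl | rfl <;>
  split_ifs <;>
  first
  | (exfalso; linarith)
  | (exfalso; norm_num at *; done)
  | (norm_num at *; done)
  | (simp only [abs_one, abs_neg, abs_zero]; first | linarith | (apply abs_le.2; constructor <;> linarith))

/-- The deficit of `u` against `stripSign c` controls the square of the measure of the set where
they differ. -/
theorem sq_measureReal_ne_le {n : ℕ} {θ : EuclideanSpace ℝ (Fin n)} (hθ : ‖θ‖ = 1) {c : ℝ}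
    (hc : 0 < c) {u : EuclideanSpace ℝ (Fin n) → ℝ} (hu : Measurable u)
    (hv : ∀ x, u x = 1 ∨ u x = -1 ∨ u x = 0) :
    (γ n).real {x | u x ≠ stripSign c (inner ℝ θ x)} ^ 2 ≤
      8 * gaussPDF 0 * (2 * gaussPDF c - ∫ x, u x * inner ℝ θ x ∂(γ n)
        - c * (2 * gaussCDF (-c) - ∫ x, |u x| ∂(γ n))) := by
  have hb : ∀ x, |u x| ≤ 1 := fun x => by rcases hv x with h | h | h <;> simp [h]
  have hm : Measurable fun x : EuclideanSpace ℝ (Fin n) => stripSign c (inner ℝ θ x) :=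
    (measurable_stripSign _).comp (by fun_prop)
  have hbs : ∀ x : EuclideanSpace ℝ (Fin n), |stripSign c (inner ℝ θ x)| ≤ 1 :=
    fun x => abs_stripSign_le _ _
  have hA : MeasurableSet {x | u x ≠ stripSign c (inner ℝ θ x)} :=
    (measurableSet_eq_fun hu hm).compl
  set A := {x | u x ≠ stripSign c (inner ℝ θ x)} with hAdef
  set m := (γ n).real A with hmdef
  have h0 := gaussPDF_pos 0
  have hm0 : 0 ≤ m := measureReal_nonneg
  -- This T maximizes mT - 2φ(0)T², with maximum m²/(8φ(0)).
  set T := m / (4 * gaussPDF 0) with hT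
  have hT0 : 0 ≤ T := by positivity
  have i1 := integrable_mul_inner hm hbs θ
  have i2 := integrable_mul_inner hu hb θ
  have i3 : Integrable (fun x => |stripSign c (inner ℝ θ x)|) (γ n) :=
    (integrable_of_abs_le_one hm hbs).abs
  have i4 := (integrable_of_abs_le_one hu hb).abs
  have i5 : Integrable (A.indicator fun _ => T) (γ n) := (integrable_const T).indicator hA
  have i6 : Integrable (fun x => max (T - |(|inner ℝ θ x| - c)|) 0) (γ n) := by
    refine Integrable.of_bound (Continuous.aestronglyMeasurable (by fun_prop)) T
      (Filter.Eventually.of_forall fun x => ?_)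
    rw [Real.norm_of_nonneg (le_max_right _ _)]
    exact max_le (by linarith [abs_nonneg (|inner ℝ θ x| - c)]) hT0
  -- On A the cost ||t| - c| is at least T minus the tent of height T; off A the left integrand is
  -- at most 0.
  have key : ∫ x, (A.indicator (fun _ => T) x - max (T - |(|inner ℝ θ x| - c)|) 0) ∂(γ n) ≤
      ∫ x, ((stripSign c (inner ℝ θ x) * inner ℝ θ x - u x * inner ℝ θ x)
        - c * (|stripSign c (inner ℝ θ x)| - |u x|)) ∂(γ n) := by
    refine integral_mono (i5.sub i6) ((i1.sub i2).sub ((i3.sub i4).const_mul c)) fun x => ?_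
    refine le_trans ?_ (stripSign_deficit hc (hv x))
    have h1 := le_max_left (T - |(|inner ℝ θ x| - c)|) 0
    have h2 := le_max_right (T - |(|inner ℝ θ x| - c)|) 0
    simp only [Set.indicator_apply, hAdef, Set.mem_ofPred_eq]
    split_ifs <;> linarith
  have e12 := integral_sub i1 i2
  have e34 := integral_sub i3 i4
  have e0 := integral_sub (i1.sub i2) ((i3.sub i4).const_mul c)
  simp only [Pi.sub_apply] at e0
  rw [integral_sub i5 i6, e0, e12, integral_const_mul, e34,
    integral_stripSign_inner_mul hθ hc, integral_abs_stripSign_inner hθ hc,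
    integral_indicator_const _ hA, smul_eq_mul, ← hmdef] at key
  have htent := integral_tent_inner_le (c := c) hθ hT0
  have e : m ^ 2 = 8 * gaussPDF 0 * (m * T - 2 * gaussPDF 0 * T ^ 2) := by
    rw [hT]; field_simp; ring
  rw [e]
  exact mul_le_mul_of_nonneg_left (by linarith) (by positivity)

/-- Both |u| and |`stripSign`| lie in [0,1], so their difference is dominated by the indicator of
the disagreement set. -/
theorem abs_integral_abs_sub_le {n : ℕ} {θ : EuclideanSpace ℝ (Fin n)} (hθ : ‖θ‖ = 1) {c : ℝ}
    (hc : 0 < c) {u : EuclideanSpace ℝ (Fin n) → ℝ} (hu : Measurable u)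
    (hb : ∀ x, |u x| ≤ 1) :
    |∫ x, |u x| ∂(γ n) - 2 * gaussCDF (-c)| ≤
      (γ n).real {x | u x ≠ stripSign c (inner ℝ θ x)} := by
  have hm : Measurable fun x : EuclideanSpace ℝ (Fin n) => stripSign c (inner ℝ θ x) :=
    (measurable_stripSign _).comp (by fun_prop)
  have hbs : ∀ x : EuclideanSpace ℝ (Fin n), |stripSign c (inner ℝ θ x)| ≤ 1 :=
    fun x => abs_stripSign_le _ _
  have hA : MeasurableSet {x | u x ≠ stripSign c (inner ℝ θ x)} :=
    (measurableSet_eq_fun hu hm).compl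
  rw [← integral_abs_stripSign_inner hθ hc, ← integral_sub (integrable_of_abs_le_one hu hb).abs
    (integrable_of_abs_le_one hm hbs).abs, ← integral_indicator_one hA]
  refine abs_integral_le_integral_abs.trans (integral_mono_of_nonneg
    (Filter.Eventually.of_forall fun x => abs_nonneg _) ((integrable_const 1).indicator hA)
    (Filter.Eventually.of_forall fun x => ?_))
  simp only [Set.indicator_apply, Set.mem_ofPred_eq, Pi.one_apply]
  split_ifs with h
  · have h1 := abs_nonneg (u x)
    have h2 := abs_nonneg (stripSign c (inner ℝ θ x))
    have h3 := hb x
    have h4 := hbs x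
    exact abs_le.2 ⟨by linarith, by linarith⟩
  · rw [not_not.1 h]; simp

theorem gaussianNorm_sub_le {n : ℕ} {f g : SignFunction n} {A : Set (EuclideanSpace ℝ (Fin n))}
    (hA : MeasurableSet A) (h : ∀ x, f x ≠ g x → x ∈ A) {η : ℝ}
    (hη : (γ n).real A ^ 2 ≤ 81 * η) :
    gaussianNorm (fun x => f x - g x) ≤ 6 * η ^ (1 / 4 : ℝ) := by
  have hη0 : 0 ≤ η := by linarith [sq_nonneg ((γ n).real A)]
  have h1 : ∫ x, (f x - g x) ^ 2 ∂(γ n) ≤ 4 * (γ n).real A := by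
    rw [← integral_indicator_one hA, ← integral_const_mul]
    refine integral_mono_of_nonneg (Filter.Eventually.of_forall fun x => sq_nonneg _)
      (((integrable_const 1).indicator hA).const_mul 4) (Filter.Eventually.of_forall fun x => ?_)
    by_cases hx : x ∈ A
    · simp only [Set.indicator_of_mem hx, Pi.one_apply]
      rcases f.sign_values x with h | h <;> rcases g.sign_values x with h' | h' <;>
        norm_num [h, h']
    · simp [Set.indicator_of_notMem hx, not_imp_comm.1 (h x) hx]
  have h2 : (η ^ (1 / 4 : ℝ)) ^ 4 = η := by
    rw [← Real.rpow_natCast, ← Real.rpow_mul hη0]; norm_num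
  have h3 : 0 ≤ η ^ (1 / 4 : ℝ) := Real.rpow_nonneg hη0 _
  -- Here 81 = 9²; with (f-g)² ≤ 4 on A, the final constant is √(4·9) = 6.
  have h4 : (γ n).real A ≤ 9 * (η ^ (1 / 4 : ℝ)) ^ 2 := by
    refine (sq_le_sq₀ measureReal_nonneg (by positivity)).1 ?_
    linarith
  refine Real.sqrt_le_iff.2 ⟨by positivity, h1.trans ?_⟩
  linarith

end

end DavieReeds

theorem mainTheorem3 (n : ℕ) [NeZero n] (η : ℝ) (f g : DavieReeds.SignFunction n)
    (hfg : DavieReeds.val (DavieReeds.davieReeds n) - η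
      ≤ DavieReeds.gameValue (DavieReeds.davieReeds n) f g) :
    ∃ fDR gDR : DavieReeds.SignFunction n,
      DavieReeds.AreStripFunctions fDR gDR ∧
      DavieReeds.gaussianNorm (fun x => f x - fDR x) ≤ 6 * η ^ (1 / 4 : ℝ) ∧
      DavieReeds.gaussianNorm (fun x => g x - gDR x) ≤ 6 * η ^ (1 / 4 : ℝ) := by
  open DavieReeds in
  obtain ⟨θ, hθ, hs⟩ := exists_unit_inner_eq_norm (firstMoment fun x => (f x + g x) / 2)
  have hC := CStar_spec.1
  have hu : Measurable fun x => (f x + g x) / 2 :=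
    (f.measurable_toFun.add g.measurable_toFun).div_const 2
  have hv : ∀ x, (f x + g x) / 2 = 1 ∨ (f x + g x) / 2 = -1 ∨ (f x + g x) / 2 = 0 := by
    intro x
    rcases f.sign_values x with h | h <;> rcases g.sign_values x with h' | h' <;>
      norm_num [h, h']
  have hb : ∀ x, |(f x + g x) / 2| ≤ 1 := fun x => by rcases hv x with h | h | h <;> simp [h]
  have hA : MeasurableSet {x | (f x + g x) / 2 ≠ stripSign CStar (inner ℝ θ x)} :=
    (measurableSet_eq_fun hu ((measurable_stripSign _).comp (by fun_prop))).compl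
  have hm : (γ n).real {x | (f x + g x) / 2 ≠ stripSign CStar (inner ℝ θ x)} ^ 2 ≤ 81 * η := by
    have hD := sq_measureReal_ne_le hθ hC hu hv
    rw [← inner_firstMoment hu hb, hs] at hD
    refine sq_le_of_deficit (norm_nonneg _)
      (MeasureTheory.integral_nonneg fun x => abs_nonneg ((f x + g x) / 2))
      MeasureTheory.measureReal_nonneg MeasureTheory.measureReal_le_one
      (abs_integral_abs_sub_le hθ hC hu hb) hD ?_
    have h1 := le_val_davieReeds n
    rw [gameValue_davieReeds_eq] at hfg
    have h2 := sq_nonneg ‖firstMoment fun x => (f x - g x) / 2‖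
    linarith
  -- Inside the strip f is kept and g is replaced by -f. Off the disagreement set nothing changes: u
  -- = 0 there means g = -f, and u = ±1 means f = g = ±1.
  refine ⟨stripModification θ f, stripModification θ f.neg,
    areStripFunctions_stripModification hθ f, gaussianNorm_sub_le hA ?_ hm,
    gaussianNorm_sub_le hA ?_ hm⟩ <;>
  · intro x
    simp only [stripModification, SignFunction.neg, stripSign, Set.mem_ofPred_eq]
    rcases f.sign_values x with h | h <;> rcases g.sign_values x with h' | h' <;>
      split_ifs <;> norm_num [h, h']
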